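/- Let $M$ be a closed (compact, boundaryless) connected smooth Riemannian manifold. For $h\in H_1(M;\mathbb{R})$ let $$\|h\|:=\inf\Big\{\sum_{i=1}^{m}|r_i|\,\ell(\sigma_i)\Big\}$$ be the stable norm, where the infimum is taken over all real Lipschitz $1$-cycles $\sum_{i=1}^m r_i\sigma_i$ (finite real combinations of Lipschitz singular $1$-simplices $\sigma_i$ with zero boundary) representing $h$, and $\ell$ denotes length. Let $\mathcal{B}(M)=\{h\in H_1(M;\mathbb{R}) : \|h\|\le 1\}$ be its unit ball. Let $i:H_1(M;\mathbb{Z})\to H_1(M;\mathbb{R})$ be the map induced by the inclusion $\mathbb{Z}\hookrightarrow\mathbb{R}$ of coefficients, and let $\mu$ be the Haar measure on the finite-dimensional real vector space $H_1(M;\mathbb{R})$ for which a fundamental domain (equivalently, a fundamental parallelepiped) of the lattice $i(H_1(M;\mathbb{Z}))$ has measure $1$. If $\gamma_1,\dots,\gamma_d$ are closed geodesics of $M$ whose homology classes form a basis of $H_1(M;\mathbb{R})$, then $$\mu(\mathcal{B}(M))\cdot\prod_{k=1}^{d}\ell(\gamma_k)\;\ge\;\frac{2^d}{d!}.$$ 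-/

import Mathlib

open MeasureTheory Set
open scoped ENNReal NNReal Manifold ContDiff Bundle

noncomputable section

/-! ### Singular homology in degree one, with coefficients in a commutative ring -/

section Homology

/-- Singular `n`-simplices of `M`. -/
abbrev SingularSimplex (M : Type*) [TopologicalSpace M] (n : ℕ) : Type _ :=
  C(stdSimplex ℝ (Fin (n + 1)), M)

/-- The `i`-th face of a singular simplex. -/
def SingularSimplex.face {M : Type*} [TopologicalSpace M] {n : ℕ} (i : Fin (n + 2))
    (σ : SingularSimplex M (n + 1)) : SingularSimplex M n :=
  σ.comp ⟨stdSimplex.map i.succAbove, stdSimplex.continuous_map _⟩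

/-- Singular `n`-chains: formal finite linear combinations of singular `n`-simplices. -/
abbrev SingularChain (R : Type*) [CommRing R] (M : Type*) [TopologicalSpace M] (n : ℕ) : Type _ :=
  SingularSimplex M n →₀ R

/-- The boundary operator `∂ σ = ∑ i, (-1) ^ i • (i-th face of σ)`. -/
def singularBoundary (R : Type*) [CommRing R] (M : Type*) [TopologicalSpace M] (n : ℕ) :
    SingularChain R M (n + 1) →ₗ[R] SingularChain R M n :=
  ∑ i : Fin (n + 2), (-1 : R) ^ (i : ℕ) • Finsupp.lmapDomain R R (SingularSimplex.face i)

/-- Singular `1`-cycles. -/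
def singularCycles₁ (R : Type*) [CommRing R] (M : Type*) [TopologicalSpace M] :
    Submodule R (SingularChain R M 1) :=
  LinearMap.ker (singularBoundary R M 0)

/-- The module of singular `1`-cycles. -/
def SingularCycle₁ (R : Type*) [CommRing R] (M : Type*) [TopologicalSpace M] : Type _ :=
  singularCycles₁ R M

instance (R : Type*) [CommRing R] (M : Type*) [TopologicalSpace M] :
    AddCommGroup (SingularCycle₁ R M) :=
  inferInstanceAs (AddCommGroup (singularCycles₁ R M))

instance (R : Type*) [CommRing R] (M : Type*) [TopologicalSpace M] :
    Module R (SingularCycle₁ R M) :=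
  inferInstanceAs (Module R (singularCycles₁ R M))

/-- The chain underlying a `1`-cycle. -/
def SingularCycle₁.chain (R : Type*) [CommRing R] (M : Type*) [TopologicalSpace M] :
    SingularCycle₁ R M →ₗ[R] SingularChain R M 1 :=
  (singularCycles₁ R M).subtype

/-- Boundaries of singular `2`-chains, inside the module of `1`-cycles. -/
def singularBoundaries₁ (R : Type*) [CommRing R] (M : Type*) [TopologicalSpace M] :
    Submodule R (SingularCycle₁ R M) :=
  (LinearMap.range (singularBoundary R M 1)).comap (SingularCycle₁.chain R M)

/-- The first singular homology module `H₁(M; R)`. -/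
def SingularH₁ (R : Type*) [CommRing R] (M : Type*) [TopologicalSpace M] : Type _ :=
  SingularCycle₁ R M ⧸ singularBoundaries₁ R M

instance (R : Type*) [CommRing R] (M : Type*) [TopologicalSpace M] :
    AddCommGroup (SingularH₁ R M) :=
  inferInstanceAs (AddCommGroup (SingularCycle₁ R M ⧸ singularBoundaries₁ R M))

instance (R : Type*) [CommRing R] (M : Type*) [TopologicalSpace M] :
    Module R (SingularH₁ R M) :=
  inferInstanceAs (Module R (SingularCycle₁ R M ⧸ singularBoundaries₁ R M))

/-- The homology class of a `1`-cycle. -/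
def singularClass (R : Type*) [CommRing R] (M : Type*) [TopologicalSpace M] :
    SingularCycle₁ R M →ₗ[R] SingularH₁ R M :=
  (singularBoundaries₁ R M).mkQ

/-- The map on chains induced by a homomorphism of coefficient rings. -/
def chainCoeffMap {R S : Type*} [CommRing R] [CommRing S] (f : R →+* S) (M : Type*)
    [TopologicalSpace M] (n : ℕ) : SingularChain R M n →+ SingularChain S M n :=
  Finsupp.mapRange.addMonoidHom f.toAddMonoidHom

lemma singularBoundary_chainCoeffMap {R S : Type*} [CommRing R] [CommRing S] (f : R →+* S)
    (M : Type*) [TopologicalSpace M] (n : ℕ) (c : SingularChain R M (n + 1)) :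
    singularBoundary S M n (chainCoeffMap f M (n + 1) c) =
      chainCoeffMap f M n (singularBoundary R M n c) := by
  induction c using Finsupp.induction_linear with
  | zero => simp
  | add a b ha hb => simp only [map_add, ha, hb]
  | single σ r =>
    simp only [singularBoundary, chainCoeffMap, LinearMap.sum_apply, LinearMap.smul_apply,
      Finsupp.lmapDomain_apply, Finsupp.mapDomain_single, Finsupp.mapRange.addMonoidHom_apply,
      Finsupp.mapRange_single, map_sum, Finsupp.smul_single, smul_eq_mul]
    simp

/-- The map on `1`-cycles induced by a homomorphism of coefficient rings. -/
def cycleCoeffMap {R S : Type*} [CommRing R] [CommRing S] (f : R →+* S) (M : Type*)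
    [TopologicalSpace M] : SingularCycle₁ R M →+ SingularCycle₁ S M where
  toFun c := ⟨chainCoeffMap f M 1 (SingularCycle₁.chain R M c), by
    have hc : singularBoundary R M 0 (SingularCycle₁.chain R M c) = 0 := c.2
    rw [singularCycles₁, LinearMap.mem_ker, singularBoundary_chainCoeffMap, hc, map_zero]⟩
  map_zero' := Subtype.ext (by simp only [map_zero]; rfl)
  map_add' a b := Subtype.ext (by simp only [map_add]; rfl)

/-- The map `H₁(M; R) → H₁(M; S)` induced by a homomorphism `R → S` of coefficient rings. -/
def homologyCoeffMap {R S : Type*} [CommRing R] [CommRing S] (f : R →+* S) (M : Type*)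
    [TopologicalSpace M] : SingularH₁ R M →+ SingularH₁ S M :=
  QuotientAddGroup.map (singularBoundaries₁ R M).toAddSubgroup
    (singularBoundaries₁ S M).toAddSubgroup (cycleCoeffMap f M) <| by
    rintro c ⟨b, hb⟩
    exact ⟨chainCoeffMap f M 2 b, by rw [singularBoundary_chainCoeffMap, hb]; rfl⟩

/-- The integer lattice `i(H₁(M; ℤ))` in `H₁(M; ℝ)`. -/
def integerLattice (M : Type*) [TopologicalSpace M] : AddSubgroup (SingularH₁ ℝ M) :=
  (homologyCoeffMap (Int.castRingHom ℝ) M).range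

end Homology

/-! ### The Haar measure on `H₁(M; ℝ)` normalized by the integer lattice -/

section Measure

/-- `H₁(M; ℝ)` carries its canonical vector space topology (the usual one in finite dimension). -/
instance (M : Type*) [TopologicalSpace M] : TopologicalSpace (SingularH₁ ℝ M) :=
  moduleTopology ℝ (SingularH₁ ℝ M)

instance (M : Type*) [TopologicalSpace M] : IsModuleTopology ℝ (SingularH₁ ℝ M) := ⟨rfl⟩

instance (M : Type*) [TopologicalSpace M] : IsTopologicalAddGroup (SingularH₁ ℝ M) :=
  IsModuleTopology.topologicalAddGroup ℝ _

instance (M : Type*) [TopologicalSpace M] : MeasurableSpace (SingularH₁ ℝ M) :=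
  borel _

instance (M : Type*) [TopologicalSpace M] : BorelSpace (SingularH₁ ℝ M) := ⟨rfl⟩

open Classical in
/-- A Haar measure on `H₁(M; ℝ)`, well defined up to a positive factor. (A compact set with
nonempty interior exists whenever `H₁(M; ℝ)` is finite dimensional.) -/
def homologyHaar (M : Type*) [TopologicalSpace M] : Measure (SingularH₁ ℝ M) :=
  if h : Nonempty (TopologicalSpace.PositiveCompacts (SingularH₁ ℝ M)) then
    Measure.addHaarMeasure h.some
  else 0

/-- The Haar measure on `H₁(M; ℝ)` for which a fundamental domain of the integer lattice
`i(H₁(M; ℤ))` has measure one. -/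
def latticeHaar (M : Type*) [TopologicalSpace M] : Measure (SingularH₁ ℝ M) :=
  (addCovolume (integerLattice M) (SingularH₁ ℝ M) (homologyHaar M))⁻¹ • homologyHaar M

end Measure

/-! ### The stable norm -/

section StableNorm

/-- The length of a singular `1`-simplex, as the supremum of the lengths of inscribed polygons. -/
def simplexLength {M : Type*} [PseudoEMetricSpace M] (σ : SingularSimplex M 1) : ℝ≥0∞ :=
  eVariationOn (fun t : unitInterval => σ (stdSimplexHomeomorphUnitInterval.symm t)) univ

/-- The stable norm: the infimum of `∑ |rᵢ| ℓ(σᵢ)` over all real Lipschitz `1`-cycles `∑ rᵢ σᵢ`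
that represent `h`. -/
def stableNorm {M : Type*} [PseudoEMetricSpace M] (h : SingularH₁ ℝ M) : ℝ≥0∞ :=
  ⨅ (c : SingularCycle₁ ℝ M)
    (_ : ∀ σ ∈ (SingularCycle₁.chain ℝ M c).support, ∃ K : ℝ≥0, LipschitzWith K σ)
    (_ : singularClass ℝ M c = h),
    (SingularCycle₁.chain ℝ M c).sum fun σ r => ‖r‖ₑ * simplexLength σ

/-- The unit ball of the stable norm. -/
def stableBall (M : Type*) [PseudoEMetricSpace M] : Set (SingularH₁ ℝ M) :=
  {h | stableNorm h ≤ 1}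

end StableNorm

/-! ### Closed geodesics -/

section Geodesics

/-- A closed geodesic, parametrized with period one: a periodic curve of constant positive speed
that locally realizes the distance. -/
structure ClosedGeodesic (M : Type*) [PseudoEMetricSpace M] where
  /-- the underlying curve -/
  curve : C(ℝ, M)
  periodic : Function.Periodic curve 1
  locally_minimizing : ∃ v : ℝ, 0 < v ∧ ∀ t : ℝ, ∃ ε > 0,
    ∀ s ∈ Ioo (t - ε) (t + ε), ∀ s' ∈ Ioo (t - ε) (t + ε),
      edist (curve s) (curve s') = ENNReal.ofReal (v * |s - s'|)

variable {M : Type*} [PseudoEMetricSpace M]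

/-- The length of a closed geodesic, over one period. -/
def ClosedGeodesic.length (γ : ClosedGeodesic M) : ℝ≥0∞ :=
  eVariationOn γ.curve (Icc 0 1)

/-- A closed geodesic as a singular `1`-simplex. -/
def ClosedGeodesic.simplex (γ : ClosedGeodesic M) : SingularSimplex M 1 :=
  γ.curve.comp ⟨fun x => (x : Fin 2 → ℝ) 1, (continuous_apply (1 : Fin 2)).comp continuous_subtype_val⟩

lemma ClosedGeodesic.single_mem_cycles (R : Type*) [CommRing R] (γ : ClosedGeodesic M) :
    Finsupp.single γ.simplex (1 : R) ∈ singularCycles₁ R M := by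
  have key : SingularSimplex.face (0 : Fin 2) γ.simplex =
      SingularSimplex.face (1 : Fin 2) γ.simplex := by
    ext x
    have h1 : γ.curve 1 = γ.curve 0 := by simpa using γ.periodic 0
    have e0 : ((stdSimplex.map (Fin.succAbove (0 : Fin 2)) x : stdSimplex ℝ (Fin 2)) :
        Fin 2 → ℝ) 1 = 1 := by
      simp [stdSimplex.map_coe, FunOnFinite.linearMap_apply_apply, Finset.filter_singleton]
    have e1 : ((stdSimplex.map (Fin.succAbove (1 : Fin 2)) x : stdSimplex ℝ (Fin 2)) :
        Fin 2 → ℝ) 1 = 0 := by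
      simp [stdSimplex.map_coe, FunOnFinite.linearMap_apply_apply]
    simp only [SingularSimplex.face, ClosedGeodesic.simplex, ContinuousMap.comp_apply,
      ContinuousMap.coe_mk]
    rw [e0, e1, h1]
  rw [singularCycles₁, LinearMap.mem_ker, singularBoundary, LinearMap.sum_apply]
  erw [Fin.sum_univ_two]
  simp only [LinearMap.smul_apply, Finsupp.lmapDomain_apply, Finsupp.mapDomain_single]
  erw [key]
  simp

/-- The homology class in `H₁(M; ℝ)` of a closed geodesic. -/
def ClosedGeodesic.homologyClass (γ : ClosedGeodesic M) : SingularH₁ ℝ M :=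
  singularClass ℝ M ⟨Finsupp.single γ.simplex 1, γ.single_mem_cycles ℝ⟩

end Geodesics

end

/-! ### The volume of a weighted cross-polytope -/

section CrossPolytope

variable {ι : Type*} [Fintype ι]

theorem volume_crossPolytope :
    volume {x : ι → ℝ | ∑ i, |x i| ≤ 1} =
      (2 : ℝ≥0∞) ^ Fintype.card ι / ((Fintype.card ι).factorial : ℝ≥0∞) := by
  rcases isEmpty_or_nonempty ι with h | h
  · simp [volume_pi]
  · have key := volume_sum_rpow_le ι (p := 1) le_rfl 1
    simp only [Real.rpow_one, div_one, ENNReal.ofReal_one, one_pow, one_mul] at key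
    rw [key, Real.Gamma_nat_eq_factorial, show (1 : ℝ) + 1 = ((1 : ℕ) : ℝ) + 1 by simp,
      Real.Gamma_nat_eq_factorial, ENNReal.ofReal_div_of_pos (by positivity)]
    simp

theorem volume_weighted_crossPolytope_mul_prod (w : ι → ℝ) (hw : ∀ i, 0 < w i) :
    volume {x : ι → ℝ | ∑ i, w i * |x i| ≤ 1} * ∏ i, ENNReal.ofReal (w i) =
      (2 : ℝ≥0∞) ^ Fintype.card ι / ((Fintype.card ι).factorial : ℝ≥0∞) := by
  classical
  have hdet : (Matrix.diagonal w).det = ∏ i, w i := Matrix.det_diagonal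
  have hpos : 0 < ∏ i, w i := Finset.prod_pos fun i _ => hw i
  have hT : MeasurableSet {x : ι → ℝ | ∑ i, |x i| ≤ 1} :=
    (isClosed_le (by fun_prop) continuous_const).measurableSet
  have hpre : Matrix.toLin' (Matrix.diagonal w) ⁻¹' {x : ι → ℝ | ∑ i, |x i| ≤ 1} =
      {x : ι → ℝ | ∑ i, w i * |x i| ≤ 1} := by
    ext x
    simp [Matrix.mulVec_diagonal, abs_mul, abs_of_pos (hw _)]
  rw [← volume_crossPolytope, ← ENNReal.ofReal_prod_of_nonneg fun i _ => (hw i).le]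
  nth_rewrite 2 [← Real.smul_map_diagonal_volume_pi (D := w) (by rw [hdet]; exact hpos.ne')]
  rw [Measure.smul_apply, Measure.map_apply (LinearMap.continuous_on_pi _).measurable hT, hpre,
    hdet, abs_of_pos hpos, smul_eq_mul, mul_comm]

end CrossPolytope

/-! ### Covolume of a subgroup that contains a basis -/

section Covolume

variable {V : Type*} [AddCommGroup V] [Module ℝ V] [TopologicalSpace V]
  [IsTopologicalAddGroup V] [MeasurableSpace V] [BorelSpace V] {ι : Type*} [Fintype ι]

open scoped Pointwise in
/-- The covolume of a subgroup that contains a basis is at most the measure of the fundamental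
parallelepiped of this basis: the translates of a fundamental domain of the subgroup by the integer
span of the basis are essentially disjoint, hence can be packed into the parallelepiped. -/
theorem addCovolume_le_measure_parallelepiped (e : V ≃L[ℝ] (ι → ℝ)) (Λ : AddSubgroup V)
    (hΛ : ∀ i, e.symm (Pi.basisFun ℝ ι i) ∈ Λ) (μ : Measure V) [μ.IsAddHaarMeasure] :
    addCovolume Λ V μ ≤ μ.map e (ZSpan.fundamentalDomain (Pi.basisFun ℝ ι)) := by
  unfold addCovolume
  split_ifs with hF
  swap
  · exact zero_le
  have hFd := hF.ExistsIsAddFundamentalDomain.choose_spec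
  set F := hF.ExistsIsAddFundamentalDomain.choose
  let L : AddSubgroup (ι → ℝ) := (Submodule.span ℤ (range (Pi.basisFun ℝ ι))).toAddSubgroup
  have hL : ∀ g ∈ L, e.symm g ∈ Λ := by
    intro g hg
    have : Submodule.span ℤ (range (Pi.basisFun ℝ ι)) ≤
        (Λ.comap (e.symm : (ι → ℝ) →+ V)).toIntSubmodule := by
      rw [Submodule.span_le]
      rintro _ ⟨i, rfl⟩
      exact hΛ i
    exact this hg
  let em : V ≃ᵐ (ι → ℝ) := e.toHomeomorph.toMeasurableEquiv
  have hem : ∀ s : Set V, μ.map e (e.symm ⁻¹' s) = μ s := by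
    intro s
    have h1 : μ.map e (e.symm ⁻¹' s) = μ (em ⁻¹' (e.symm ⁻¹' s)) := em.map_apply _
    have h2 : em ⁻¹' (e.symm ⁻¹' s) = s := by
      ext x
      exact iff_of_eq (congrArg (· ∈ s) (e.symm_apply_apply x))
    rw [h1, h2]
  have : (μ.map e).IsAddHaarMeasure := e.isAddHaarMeasure_map μ
  have hdom := ZSpan.isAddFundamentalDomain' (Pi.basisFun ℝ ι) (μ.map e)
  rw [← hem F]
  have : Countable L := inferInstanceAs (Countable (Submodule.span ℤ (range (Pi.basisFun ℝ ι))))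
  refine hdom.measure_le_of_pairwise_disjoint ?_ ?_
  · refine hFd.nullMeasurableSet.preimage ⟨e.symm.continuous.measurable, ?_⟩
    rw [Measure.map_map e.symm.continuous.measurable e.continuous.measurable]
    simp [Measure.AbsolutelyContinuous.rfl]
  · intro g g' hgg'
    have hne : (⟨e.symm g, hL g g.2⟩ : Λ) ≠ ⟨e.symm g', hL g' g'.2⟩ := by
      intro h
      exact hgg' (Subtype.ext (e.symm.injective (congrArg Subtype.val h)))
    have hdis : μ _ = 0 := hFd.aedisjoint hne
    have hpre : ∀ h : L, h +ᵥ (e.symm ⁻¹' F) =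
        e.symm ⁻¹' ((⟨e.symm h, hL h h.2⟩ : Λ) +ᵥ F) := by
      intro h
      ext x
      rw [mem_vadd_set_iff_neg_vadd_mem, mem_preimage, mem_preimage,
        mem_vadd_set_iff_neg_vadd_mem]
      change e.symm (-(h : ι → ℝ) + x) ∈ F ↔ -(e.symm h) + e.symm x ∈ F
      rw [map_add, map_neg]
    refine AEDisjoint.mono ?_ inter_subset_left inter_subset_left
    change μ.map e ((g +ᵥ (e.symm ⁻¹' F)) ∩ (g' +ᵥ (e.symm ⁻¹' F))) = 0
    rw [hpre, hpre, ← preimage_inter, hem]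
    exact hdis

/-- Normalizing a Haar measure by the covolume of a subgroup that contains a basis gives a measure
that is at least Lebesgue measure in the coordinates of this basis. -/
theorem volume_le_addCovolume_inv_smul (e : V ≃L[ℝ] (ι → ℝ)) (Λ : AddSubgroup V)
    (hΛ : ∀ i, e.symm (Pi.basisFun ℝ ι i) ∈ Λ) (μ : Measure V) [μ.IsAddHaarMeasure]
    (s : Set (ι → ℝ)) :
    volume s ≤ ((addCovolume Λ V μ)⁻¹ • μ) (e ⁻¹' s) := by
  have : (μ.map e).IsAddHaarMeasure := e.isAddHaarMeasure_map μ
  have hce := Measure.isAddLeftInvariant_eq_smul (μ.map e) volume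
  let c : ℝ≥0∞ := (Measure.addHaarScalarFactor (μ.map e) (volume : Measure (ι → ℝ)) : ℝ≥0)
  have hc : c ≠ ⊤ := ENNReal.coe_ne_top
  have hc0 : c ≠ 0 := ENNReal.coe_ne_zero.2
    (Measure.addHaarScalarFactor_pos_of_isAddHaarMeasure _ _).ne'
  change μ.map e = c • volume at hce
  have hcov : addCovolume Λ V μ ≤ c := by
    refine (addCovolume_le_measure_parallelepiped e Λ hΛ μ).trans_eq ?_
    rw [hce, Measure.smul_apply, ZSpan.fundamentalDomain_pi_basisFun, volume_pi_pi]
    simp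
  have hs : μ (e ⁻¹' s) = c * volume s := by
    have : μ.map e s = μ (e ⁻¹' s) := e.toHomeomorph.toMeasurableEquiv.map_apply s
    rw [← this, hce, Measure.smul_apply, smul_eq_mul]
  rw [Measure.smul_apply, hs, smul_eq_mul, ← mul_assoc]
  calc volume s = c⁻¹ * c * volume s := by rw [ENNReal.inv_mul_cancel hc0 hc, one_mul]
    _ ≤ _ := by gcongr

end Covolume

/-! ### Closed geodesics -/

section Geodesics

/-- A map on the line that is locally `K`-Lipschitz is globally `K`-Lipschitz. -/
theorem lipschitzWith_of_forall_exists_lipschitzOnWith {E : Type*} [PseudoEMetricSpace E]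
    {f : ℝ → E} {K : ℝ≥0} (h : ∀ t, ∃ ε > 0, LipschitzOnWith K f (Ioo (t - ε) (t + ε))) :
    LipschitzWith K f := by
  have key : ∀ a b, a ≤ b → edist (f a) (f b) ≤ K * edist a b := by
    intro a b hab
    let s : Set ℝ := {t | edist (f a) (f t) ≤ K * edist a t}
    have hcont : Continuous f := by
      rw [continuous_iff_continuousAt]
      intro t
      obtain ⟨ε, hε, hl⟩ := h t
      exact hl.continuousOn.continuousAt (Ioo_mem_nhds (by linarith) (by linarith))
    have hs : IsClosed s :=
      isClosed_le (by fun_prop) ((ENNReal.continuous_const_mul ENNReal.coe_ne_top).comp (by fun_prop))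
    refine (hs.inter isClosed_Icc).Icc_subset_of_forall_mem_nhdsWithin (a := a) (b := b)
      (by simp [s]) ?_ ⟨hab, le_rfl⟩
    rintro x ⟨hx, hxa, -⟩
    obtain ⟨ε, hε, hl⟩ := h x
    filter_upwards [Ioo_mem_nhdsGT (show x < x + ε by linarith)] with y hy
    calc edist (f a) (f y) ≤ edist (f a) (f x) + edist (f x) (f y) := edist_triangle ..
      _ ≤ K * edist a x + K * edist x y := by
        gcongr
        · exact hx
        · exact hl ⟨by linarith, by linarith⟩ ⟨by linarith [hy.1], hy.2⟩
      _ = K * edist a y := by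
        rw [← mul_add, edist_dist, edist_dist, edist_dist,
          ← ENNReal.ofReal_add dist_nonneg dist_nonneg, Real.dist_eq, Real.dist_eq, Real.dist_eq,
          abs_sub_comm a x, abs_sub_comm x y, abs_sub_comm a y, abs_of_nonneg (by linarith),
          abs_of_nonneg (by linarith [hy.1]), abs_of_nonneg (by linarith [hy.1])]
        congr 2
        ring
  intro a b
  rcases le_total a b with hab | hab
  · exact key a b hab
  · rw [edist_comm, edist_comm a]
    exact key b a hab

variable {M : Type*} [PseudoEMetricSpace M]

theorem ClosedGeodesic.exists_lipschitzWith (γ : ClosedGeodesic M) :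
    ∃ K : ℝ≥0, LipschitzWith K γ.curve := by
  obtain ⟨v, hv, h⟩ := γ.locally_minimizing
  refine ⟨v.toNNReal, lipschitzWith_of_forall_exists_lipschitzOnWith fun t => ?_⟩
  obtain ⟨ε, hε, hs⟩ := h t
  refine ⟨ε, hε, fun s hs' s' hs'' => ?_⟩
  rw [hs s hs' s' hs'', ENNReal.ofReal_mul hv.le, edist_dist, Real.dist_eq]
  rfl

theorem ClosedGeodesic.length_ne_top (γ : ClosedGeodesic M) : γ.length ≠ ⊤ := by
  obtain ⟨K, hK⟩ := γ.exists_lipschitzWith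
  refine ne_top_of_le_ne_top ?_
    ((hK.lipschitzOnWith (s := univ)).comp_eVariationOn_le (g := id) (s := Icc 0 1) (by simp))
  exact ENNReal.mul_ne_top ENNReal.coe_ne_top (by simp)

theorem ClosedGeodesic.length_pos (γ : ClosedGeodesic M) : 0 < γ.length := by
  obtain ⟨v, hv, h⟩ := γ.locally_minimizing
  obtain ⟨ε, hε, hs⟩ := h 0
  have hδ : 0 < min (ε / 2) 1 := by positivity
  have hδε : min (ε / 2) 1 ≤ ε / 2 := min_le_left ..
  have hd := hs 0 ⟨by linarith, by linarith⟩ (min (ε / 2) 1) ⟨by linarith, by linarith⟩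
  refine lt_of_lt_of_le ?_ (eVariationOn.edist_le γ.curve (s := Icc 0 1) (x := 0)
    (y := min (ε / 2) 1) (by simp) ⟨hδ.le, min_le_right ..⟩)
  rw [hd, ENNReal.ofReal_pos, zero_sub, abs_neg]
  positivity

theorem ClosedGeodesic.exists_lipschitzWith_simplex (γ : ClosedGeodesic M) :
    ∃ K : ℝ≥0, LipschitzWith K γ.simplex := by
  obtain ⟨K, hK⟩ := γ.exists_lipschitzWith
  refine ⟨K * (1 * 1), hK.comp ?_⟩
  exact (LipschitzWith.eval (α := fun _ : Fin 2 => ℝ) 1).comp (LipschitzWith.subtype_val _)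

theorem ClosedGeodesic.simplexLength_simplex_le (γ : ClosedGeodesic M) :
    simplexLength γ.simplex ≤ γ.length :=
  eVariationOn.comp_le_of_monotoneOn γ.curve (fun t : unitInterval => (t : ℝ))
    (fun _ _ _ _ h => h) (fun t _ => t.2)

theorem ClosedGeodesic.homologyClass_mem_integerLattice (γ : ClosedGeodesic M) :
    γ.homologyClass ∈ integerLattice M := by
  refine ⟨singularClass ℤ M ⟨Finsupp.single γ.simplex 1, γ.single_mem_cycles ℤ⟩, ?_⟩
  have : cycleCoeffMap (Int.castRingHom ℝ) M
      ⟨Finsupp.single γ.simplex 1, γ.single_mem_cycles ℤ⟩ =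
      ⟨Finsupp.single γ.simplex 1, γ.single_mem_cycles ℝ⟩ := by
    refine Subtype.ext ?_
    change Finsupp.mapRange _ (map_zero _) (Finsupp.single γ.simplex (1 : ℤ)) = _
    rw [Finsupp.mapRange_single]
    simp
  exact congrArg (singularClass ℝ M) this

/-- The stable norm of a combination of closed geodesics is at most its mass. -/
theorem stableNorm_sum_smul_homologyClass_le {ι : Type*} [Fintype ι] (γ : ι → ClosedGeodesic M)
    (a : ι → ℝ) :
    stableNorm (∑ k, a k • (γ k).homologyClass) ≤ ∑ k, ‖a k‖ₑ * (γ k).length := by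
  classical
  let z : ι → SingularCycle₁ ℝ M := fun k =>
    ⟨Finsupp.single (γ k).simplex 1, (γ k).single_mem_cycles ℝ⟩
  let c : SingularCycle₁ ℝ M := ∑ k, a k • z k
  have hc : SingularCycle₁.chain ℝ M c = ∑ k, Finsupp.single (γ k).simplex (a k) := by
    rw [map_sum]
    refine Finset.sum_congr rfl fun k _ => ?_
    rw [map_smul]
    change a k • Finsupp.single (γ k).simplex (1 : ℝ) = _
    rw [Finsupp.smul_single, smul_eq_mul, mul_one]
  have hclass : singularClass ℝ M c = ∑ k, a k • (γ k).homologyClass := by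
    rw [map_sum]
    exact Finset.sum_congr rfl fun k _ => map_smul _ _ _
  refine (iInf_le _ c).trans <| (iInf_le _ ?_).trans <| (iInf_le _ hclass).trans ?_
  · intro σ hσ
    rw [hc] at hσ
    obtain ⟨k, -, hk⟩ := Finset.mem_biUnion.mp (Finsupp.support_finsetSum hσ)
    have := Finsupp.support_single_subset hk
    rw [Finset.mem_singleton] at this
    rw [this]
    exact (γ k).exists_lipschitzWith_simplex
  · rw [hc]
    have hsub : ∀ s : Finset ι, (∑ k ∈ s, Finsupp.single (γ k).simplex (a k)).sum
        (fun σ r => ‖r‖ₑ * simplexLength σ) ≤ ∑ k ∈ s, ‖a k‖ₑ * (γ k).length := by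
      intro s
      induction s using Finset.induction_on with
      | empty => simp
      | insert k s hk ih =>
        rw [Finset.sum_insert hk, Finset.sum_insert hk]
        refine le_trans ?_ (add_le_add
          (mul_le_mul_right (γ k).simplexLength_simplex_le ‖a k‖ₑ) ih)
        refine le_trans ?_ (add_le_add_left (Finsupp.sum_single_index
          (h := fun (σ : SingularSimplex M 1) (r : ℝ) => ‖r‖ₑ * simplexLength σ) (by simp)).le _)
        set f := Finsupp.single (γ k).simplex (a k)
        set g := ∑ k ∈ s, Finsupp.single (γ k).simplex (a k)
        rw [Finsupp.sum_of_support_subset (s := f.support ∪ g.support) _ Finsupp.support_add _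
            (by simp),
          Finsupp.sum_of_support_subset (s := f.support ∪ g.support) f
            Finset.subset_union_left _ (by simp),
          Finsupp.sum_of_support_subset (s := f.support ∪ g.support) g
            Finset.subset_union_right _ (by simp), ← Finset.sum_add_distrib]
        refine Finset.sum_le_sum fun σ _ => ?_
        rw [← add_mul]
        gcongr
        exact enorm_add_le _ _
    exact hsub Finset.univ

end Geodesics

theorem isAddHaarMeasure_homologyHaar {M : Type*} [TopologicalSpace M] {ι : Type*} [Fintype ι]
    (e : SingularH₁ ℝ M ≃L[ℝ] (ι → ℝ)) : (homologyHaar M).IsAddHaarMeasure := by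
  have : LocallyCompactSpace (SingularH₁ ℝ M) :=
    e.toHomeomorph.isClosedEmbedding.locallyCompactSpace
  have h : Nonempty (TopologicalSpace.PositiveCompacts (SingularH₁ ℝ M)) := inferInstance
  rw [homologyHaar, dif_pos h]
  infer_instance

theorem mainTheorem12 {n : ℕ} {M : Type*} [EMetricSpace M]
    [ChartedSpace (EuclideanSpace ℝ (Fin n)) M] [IsManifold (𝓡 n) ∞ M]
    [Bundle.RiemannianBundle (fun x : M => TangentSpace (𝓡 n) x)]
    [IsContMDiffRiemannianBundle (𝓡 n) ∞ (EuclideanSpace ℝ (Fin n))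
      (fun x : M => TangentSpace (𝓡 n) x)]
    [IsRiemannianManifold (𝓡 n) M] [CompactSpace M] [ConnectedSpace M]
    {d : ℕ} (γ : Fin d → ClosedGeodesic M)
    (hli : LinearIndependent ℝ fun k => (γ k).homologyClass)
    (hspan : Submodule.span ℝ (Set.range fun k => (γ k).homologyClass) = ⊤) :
    (2 : ℝ≥0∞) ^ d / (d.factorial : ℝ≥0∞) ≤
      latticeHaar M (stableBall M) * ∏ k, (γ k).length := by
  let b : Module.Basis (Fin d) ℝ (SingularH₁ ℝ M) := .mk hli hspan.ge
  have hb : ∀ k, b k = (γ k).homologyClass := Module.Basis.mk_apply hli hspan.ge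
  let e : SingularH₁ ℝ M ≃L[ℝ] (Fin d → ℝ) :=
    { b.equivFun with
      continuous_toFun := IsModuleTopology.continuous_of_linearMap b.equivFun.toLinearMap
      continuous_invFun := IsModuleTopology.continuous_of_linearMap b.equivFun.symm.toLinearMap }
  have he : ∀ k, e.symm (Pi.basisFun ℝ (Fin d) k) ∈ integerLattice M := by
    intro k
    have : e.symm (Pi.basisFun ℝ (Fin d) k) = b k := by
      change b.equivFun.symm (Pi.basisFun ℝ (Fin d) k) = b k
      rw [Pi.basisFun_apply, LinearEquiv.symm_apply_eq]
      ext j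
      simp [Module.Basis.equivFun_self, Pi.single_apply, eq_comm]
    rw [this, hb]
    exact (γ k).homologyClass_mem_integerLattice
  have := isAddHaarMeasure_homologyHaar e
  let w : Fin d → ℝ := fun k => (γ k).length.toReal
  have hw : ∀ k, ENNReal.ofReal (w k) = (γ k).length := fun k =>
    ENNReal.ofReal_toReal (γ k).length_ne_top
  have hw0 : ∀ k, 0 < w k := fun k =>
    ENNReal.toReal_pos (γ k).length_pos.ne' (γ k).length_ne_top
  have hvol := volume_weighted_crossPolytope_mul_prod w hw0
  simp only [hw, Fintype.card_fin] at hvol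
  rw [← hvol]
  gcongr
  refine (volume_le_addCovolume_inv_smul e _ he (homologyHaar M) _).trans (measure_mono ?_)
  intro h hh
  have hrepr : ∑ k, e h k • (γ k).homologyClass = h := by
    simp only [← hb]
    exact b.sum_equivFun h
  change stableNorm h ≤ 1
  rw [← hrepr]
  refine (stableNorm_sum_smul_homologyClass_le γ (e h)).trans ?_
  have hsum : ∑ k, ‖e h k‖ₑ * (γ k).length = ENNReal.ofReal (∑ k, w k * |e h k|) := by
    rw [ENNReal.ofReal_sum_of_nonneg fun k _ => mul_nonneg (hw0 k).le (abs_nonneg _)]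
    refine Finset.sum_congr rfl fun k _ => ?_
    rw [ENNReal.ofReal_mul (hw0 k).le, hw, mul_comm, Real.enorm_eq_ofReal_abs]
  rw [hsum, ← ENNReal.ofReal_one]
  exact ENNReal.ofReal_le_ofReal hh
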